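/- Let $q$ be a prime power, $\mathbb F_q$ the field with $q$ elements, $n$ a natural number, and let $U=U_n(q)$ be the group of upper triangular $n\times n$ matrices over $\mathbb F_q$ with ones on the diagonal. The positive roots are $\alpha_{i,j}$ with $1\le i\le j<n$; $\alpha_{i,j}$ lies in row $i$ and column $j+1$ of the matrix. Its root subgroup is $X_{\alpha_{i,j}}=\{x_{\alpha_{i,j}}(c)=I_n+c\,e_{i,j+1}: c\in\mathbb F_q\}$, and $\mathrm{arm}(\alpha_{i,j})=\{\alpha_{i,k}: i\le k<j\}$. Write $\Sigma^+$ for the set of positive roots, and put $V_\alpha=\langle X_\beta:\beta\in\Sigma^+\setminus \mathrm{arm}(\alpha)\rangle$ for $\alpha\in\Sigma^+$. Fix a nontrivial character $\varphi:(\mathbb F_q,+)\to\mathbb C^\times$. For $\alpha\in\Sigma^+$ and $s\in\mathbb F_q^\times$ let $\lambda_{\alpha,s}$ be the linear character of $V_\alpha$ with $\lambda_{\alpha,s}(x_\alpha(d))=\varphi(ds)$ for $d\in\mathbb F_q$ that is trivial on every $X_\beta\subseteq V_\alpha$ with $\beta\ne\alpha$. A basic set $D$ is a nonempty subset of $\Sigma^+$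 no two distinct elements of which lie in the same row or in the same column, and $E(D)$ denotes the set of families $\phi=(\lambda_{\alpha,s_\alpha})_{\alpha\in D}$ with all $s_\alpha\in\mathbb F_q^\times$. For a basic set $D$ and $\phi\in E(D)$ the supercharacter is $$\xi_{D,\phi}=\prod_{\alpha\in D}(\lambda_{\alpha,s_\alpha})^U ,$$ where $(\cdot)^U$ denotes the induced character. Put $V_D=\bigcap_{\alpha\in D}V_\alpha$ and $R_D=\langle X_\gamma:\gamma\in\Gamma_D\rangle$, where $\Gamma_D$ consists of the roots $\alpha_{m,l-1}$ for all pairs $\alpha_{m,i},\alpha_{l,j}\in D$ with $i<j$ and $m<l$. Let $V_DR_D=\langle V_D,R_D\rangle$ be the subgroup generated by $V_D$ and $R_D$. Then, for all basic sets $D,D'$ and all $\phi\in E(D)$, $\phi'\in E(D')$, $$(\xi_{D,\phi},\xi_{D',\phi'})=\begin{cases}[V_DR_D:V_D]&\text{if }(D,\phi)=(D',\phi'),\\ 0&\text{otherwise,}\end{cases}$$ where $(\chi,\psi)=\frac1{|U|}\sum_{g\in U}\chi(g)\overline{\psi(g)}$ is the usual inner product of characters. -/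

import Mathlib

/-! ### Class functions on a finite group -/

section ClassFunctions

variable {G : Type*} [Group G] [Fintype G]

open Classical in
/-- The function on `G` induced from a function `f` on the subgroup `H`:
`f^G (g) = |H|⁻¹ ∑_{x ∈ G, x⁻¹ g x ∈ H} f (x⁻¹ g x)`. -/
noncomputable def inducedCharacter (H : Subgroup G) (f : H → ℂ) : G → ℂ := fun g =>
  (Nat.card H : ℂ)⁻¹ *
    ∑ x : G, if h : x⁻¹ * g * x ∈ H then f ⟨x⁻¹ * g * x, h⟩ else 0

/-- The usual inner product `(χ, ψ) = |G|⁻¹ ∑_{g ∈ G} χ(g) conj(ψ(g))`. -/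
noncomputable def charInner (χ ψ : G → ℂ) : ℂ :=
  (Nat.card G : ℂ)⁻¹ * ∑ g : G, χ g * (starRingEnd ℂ) (ψ g)

end ClassFunctions

/-! ### Positive roots and the group `U_n(q)` -/

/-- Positive roots of type `A_{n-1}`, encoded by their matrix position strictly above the diagonal:
`α_{i,j} = α_i + ⋯ + α_j` is the position in row `i` and column `j + 1`
(indices in `Fin n` start at `0`). -/
@[ext]
structure PosRoot (n : ℕ) where
  row : Fin n
  col : Fin n
  row_lt_col : row < col

/-- `arm α`: the roots in the row of `α`, strictly to the left of `α`. -/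
def PosRoot.arm {n : ℕ} (α : PosRoot n) : Set (PosRoot n) :=
  {β | β.row = α.row ∧ β.col < α.col}

/-- The group `U_n(F)` of upper triangular matrices with ones on the diagonal. -/
def unitriangular (n : ℕ) (F : Type*) [Field F] : Subgroup (GL (Fin n) F) where
  carrier := {g | (∀ i, g.val i i = 1) ∧ ∀ i j, j < i → g.val i j = 0}
  one_mem' := by
    refine ⟨fun i => by simp, fun i j h => ?_⟩
    simp [h.ne']
  mul_mem' := by
    rintro a b ⟨ha, ha'⟩ ⟨hb, hb'⟩
    refine ⟨fun i => ?_, fun i j h => ?_⟩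
    · rw [Units.val_mul, Matrix.mul_apply, Finset.sum_eq_single i]
      · rw [ha, hb, one_mul]
      · intro k _ hk
        rcases lt_or_gt_of_ne hk with h | h
        · rw [ha' i k h, zero_mul]
        · rw [hb' k i h, mul_zero]
      · simp
    · rw [Units.val_mul, Matrix.mul_apply]
      refine Finset.sum_eq_zero fun k _ => ?_
      rcases lt_or_ge k i with hk | hk
      · rw [ha' i k hk, zero_mul]
      · rw [hb' k j (h.trans_le hk), mul_zero]
  inv_mem' := by
    rintro a ⟨ha, ha'⟩
    have hT : Matrix.BlockTriangular a.val id := fun i j h => ha' i j h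
    have : Invertible a.val := a.invertible
    have hT' : Matrix.BlockTriangular (a.val)⁻¹ id :=
      Matrix.blockTriangular_inv_of_blockTriangular hT
    rw [← Matrix.coe_units_inv] at hT'
    have hinv : ∀ i j, j < i → (a⁻¹).val i j = 0 := fun i j h => hT' h
    refine ⟨fun i => ?_, hinv⟩
    have h1 : (a.val * (a⁻¹).val) i i = 1 := by rw [Units.mul_inv]; simp
    rw [Matrix.mul_apply, Finset.sum_eq_single i] at h1
    · rwa [ha, one_mul] at h1
    · intro k _ hk
      rcases lt_or_gt_of_ne hk with h | h
      · rw [ha' i k h, zero_mul]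
      · rw [hinv k i h, mul_zero]
    · simp

noncomputable instance unitriangularFintype (n : ℕ) (F : Type*) [Field F] [Finite F] :
    Fintype (unitriangular n F) :=
  haveI : Finite (Matrix (Fin n) (Fin n) F) := inferInstanceAs (Finite (Fin n → Fin n → F))
  Fintype.ofFinite _

section Pattern

variable {n : ℕ} {F : Type*} [Field F]

/-- The one-parameter subgroup `c ↦ x_α(c) = I_n + c e_α` of `U_n(F)`. -/
def rootElem (α : PosRoot n) : Multiplicative F →* unitriangular n F where
  toFun c :=
    ⟨⟨Matrix.transvection α.row α.col c.toAdd, Matrix.transvection α.row α.col (-c.toAdd),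
        by simp [Matrix.transvection_mul_transvection_same _ _ α.row_lt_col.ne],
        by simp [Matrix.transvection_mul_transvection_same _ _ α.row_lt_col.ne]⟩, by
      refine ⟨fun i => ?_, fun i j h => ?_⟩
      · have : ¬ (α.row = i ∧ α.col = i) := fun h => α.row_lt_col.ne (h.1.trans h.2.symm)
        simp [Matrix.transvection, this]
      · have : ¬ (α.row = i ∧ α.col = j) := fun h' =>
          absurd α.row_lt_col (by rw [h'.1, h'.2]; exact h.not_gt)
        simp [Matrix.transvection, this, h.ne']⟩
  map_one' := by
    ext i j; simp
  map_mul' a b := by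
    apply Subtype.ext
    apply Units.ext
    simp [Matrix.transvection_mul_transvection_same _ _ α.row_lt_col.ne]

variable (F) in
/-- The root subgroup `X_α = {I_n + c e_α : c ∈ F}`. -/
def rootSubgroup (α : PosRoot n) : Subgroup (unitriangular n F) := (rootElem (F := F) α).range

variable (F) in
/-- The subgroup `⟨X_α : α ∈ S⟩` of `U_n(F)`. -/
def rootGenerated (S : Set (PosRoot n)) : Subgroup (unitriangular n F) :=
  ⨆ α ∈ S, rootSubgroup F α

variable (F) in
/-- The base group `V_α = ⟨X_β : β ∈ Σ⁺ ∖ arm(α)⟩`. -/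
def baseGroup (α : PosRoot n) : Subgroup (unitriangular n F) := rootGenerated F (α.arm)ᶜ

/-- `IsBaseChar φ α s l` says that the linear character `l` of `V_α` is `λ_{α,s}`: it restricts to
`x_α(d) ↦ φ(ds)` on `X_α` and is trivial on every other `X_β ⊆ V_α`. -/
def IsBaseChar (φ : AddChar F ℂ) (α : PosRoot n) (s : F) (l : baseGroup F α →* ℂˣ) : Prop :=
  (∀ (d : F) (h : rootElem α (Multiplicative.ofAdd d) ∈ baseGroup F α),
      ((l ⟨rootElem α (Multiplicative.ofAdd d), h⟩ : ℂˣ) : ℂ) = φ (d * s)) ∧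
  ∀ β : PosRoot n, β ≠ α → rootSubgroup F β ≤ baseGroup F α →
    ∀ x : baseGroup F α, (x : unitriangular n F) ∈ rootSubgroup F β → l x = 1

/-- The set `Irr(V_α/[V_α,V_α])^×` of all linear characters `λ_{α,s}` of `V_α`, `s ∈ F^×`. -/
def baseChars (φ : AddChar F ℂ) (α : PosRoot n) : Set (baseGroup F α →* ℂˣ) :=
  {l | ∃ s : F, s ≠ 0 ∧ IsBaseChar φ α s l}

/-! Every `λ_{α,s}` exists. -/

theorem rootSubgroup_le_baseGroup {α β : PosRoot n} (h : β ∉ α.arm) :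
    rootSubgroup F β ≤ baseGroup F α :=
  le_iSup₂_of_le (f := fun γ (_ : γ ∈ (α.arm)ᶜ) => rootSubgroup F γ) β h le_rfl

theorem rootElem_val (α : PosRoot n) (c : Multiplicative F) (i j : Fin n) :
    (rootElem α c).val.val i j =
      (1 : Matrix (Fin n) (Fin n) F) i j + if α.row = i ∧ α.col = j then c.toAdd else 0 := by
  simp [rootElem, Matrix.transvection, Matrix.single_apply]

/-- If `x` has zero entries on `arm α`, the entry at `α` is additive at products `x y`. -/
theorem mul_entry_of_arm_eq_zero (i j : Fin n) (x y : unitriangular n F)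
    (hx : ∀ k, i < k → k < j → x.val.val i k = 0) (hij : i < j) :
    (x * y).val.val i j = x.val.val i j + y.val.val i j := by
  rw [Subgroup.coe_mul, Units.val_mul, Matrix.mul_apply,
    ← Finset.add_sum_erase _ _ (Finset.mem_univ i),
    ← Finset.add_sum_erase _ _ (Finset.mem_erase.2 ⟨hij.ne', Finset.mem_univ j⟩),
    Finset.sum_eq_zero, x.2.1, y.2.1]
  · ring
  · intro k hk
    simp only [Finset.mem_erase, Finset.mem_univ, and_true] at hk
    rcases lt_or_gt_of_ne hk.2 with h | h
    · rw [x.2.2 i k h, zero_mul]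
    · rcases lt_or_gt_of_ne hk.1 with h' | h'
      · rw [hx k h h', zero_mul]
      · rw [y.2.2 k j h', mul_zero]

theorem entry_eq_zero_of_mem_baseGroup {α : PosRoot n} {x : unitriangular n F}
    (hx : x ∈ baseGroup F α) : ∀ k, α.row < k → k < α.col → x.val.val α.row k = 0 := by
  unfold baseGroup rootGenerated at hx
  rw [iSup_subtype'] at hx
  refine Subgroup.iSup_induction _ (C := fun y : unitriangular n F =>
    ∀ k, α.row < k → k < α.col → y.val.val α.row k = 0) hx ?_ ?_ ?_
  · rintro ⟨β, hβ⟩ _ ⟨c, rfl⟩ k hk hk'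
    have : ¬ (β.row = α.row ∧ β.col = k) := fun h => hβ ⟨h.1, h.2 ▸ hk'⟩
    rw [rootElem_val, if_neg this, add_zero, Matrix.one_apply_ne hk.ne]
  · intro k hk _
    exact Matrix.one_apply_ne hk.ne
  · intro x y hx hy k hk hk'
    rw [mul_entry_of_arm_eq_zero _ _ _ _ (fun l h h' => hx l h (h'.trans hk')) hk, hx k hk hk',
      hy k hk hk', add_zero]

theorem exists_isBaseChar (φ : AddChar F ℂ) (α : PosRoot n) (s : F) :
    ∃ l : baseGroup F α →* ℂˣ, IsBaseChar φ α s l := by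
  let l₀ : baseGroup F α →* ℂ :=
    { toFun := fun x => φ (x.1.val.val α.row α.col * s)
      map_one' := by
        have : ((1 : baseGroup F α).1.val.val α.row α.col) = 0 :=
          Matrix.one_apply_ne α.row_lt_col.ne
        rw [this, zero_mul, AddChar.map_zero_eq_one]
      map_mul' := fun x y => by
        rw [← AddChar.map_add_eq_mul, ← add_mul, ← mul_entry_of_arm_eq_zero _ _ _ _
          (entry_eq_zero_of_mem_baseGroup x.2) α.row_lt_col]
        rfl }
  refine ⟨l₀.toHomUnits, fun d h => ?_, fun β hβ _ x hx => ?_⟩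
  · change φ ((rootElem α (Multiplicative.ofAdd d)).val.val α.row α.col * s) = _
    rw [rootElem_val, if_pos ⟨rfl, rfl⟩, Matrix.one_apply_ne α.row_lt_col.ne, zero_add]
    rfl
  · apply Units.ext
    change φ (x.1.val.val α.row α.col * s) = 1
    obtain ⟨c, hc⟩ := hx
    have : ¬ (β.row = α.row ∧ β.col = α.col) := fun h => hβ (PosRoot.ext h.1 h.2)
    rw [← hc, rootElem_val, if_neg this, Matrix.one_apply_ne α.row_lt_col.ne, add_zero, zero_mul,
      AddChar.map_zero_eq_one]

end Pattern

/-! ### Basic sets and supercharacters -/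

/-- A basic set: a nonempty set of positive roots, no two on the same row or the same column. -/
def IsBasic {n : ℕ} (D : Finset (PosRoot n)) : Prop :=
  D.Nonempty ∧ ∀ α ∈ D, ∀ β ∈ D, α ≠ β → α.row ≠ β.row ∧ α.col ≠ β.col

section Super

variable {n : ℕ} {F : Type*} [Field F]

/-- `E(D)`: a choice of some `λ_{α,s} ∈ Irr(V_α/[V_α,V_α])^×` for each `α ∈ D`. -/
abbrev CharChoice (φ : AddChar F ℂ) (D : Finset (PosRoot n)) : Type _ :=
  (α : D) → baseChars φ (α : PosRoot n)

/-- The pairs `(D, ϕ)` with `D` a basic set and `ϕ ∈ E(D)`. -/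
abbrev BasicPair (n : ℕ) (φ : AddChar F ℂ) : Type _ :=
  Σ D : {D : Finset (PosRoot n) // IsBasic D}, CharChoice φ D.1

/-- The supercharacter `ξ_{D,ϕ}`, the product over `α ∈ D` of the elementary characters
`λ_{α,s}^U`, `λ_{α,s} ∈ ϕ`. -/
noncomputable def supercharacter [Finite F] {φ : AddChar F ℂ} (P : BasicPair n φ) :
    unitriangular n F → ℂ := fun g =>
  ∏ α : P.1.1, inducedCharacter (baseGroup F α.1) (fun x => (((P.2 α).1 x : ℂˣ) : ℂ)) g

variable (F) in
/-- `V_D = ⋂_{α ∈ D} V_α`. -/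
def VD (D : Finset (PosRoot n)) : Subgroup (unitriangular n F) := ⨅ α ∈ D, baseGroup F α

/-- `Γ_D`: the set of the roots `γ` attached to the pairs `τ, τ' ∈ D` such that `τ'` is strictly to
the right of `τ` and strictly below `τ`; here `γ` is the root on the row of `τ` such that
`γ + τ'` is a root, that is, the column of `γ` has the index of the row of `τ'`. -/
def GammaD (D : Finset (PosRoot n)) : Set (PosRoot n) :=
  {γ | ∃ τ ∈ D, ∃ τ' ∈ D, τ.col < τ'.col ∧ τ.row < τ'.row ∧ γ.row = τ.row ∧ γ.col = τ'.row}

variable (F) in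
/-- `R_D = ⟨X_γ : γ ∈ Γ_D⟩`. -/
def RD (D : Finset (PosRoot n)) : Subgroup (unitriangular n F) := rootGenerated F (GammaD D)

end Super

/-! The proof is an orbit method for the two-sided action of U on linear forms on strictly upper
triangular matrices. Write q = |F| and, for D with coefficients t, let λ_D(a) = ∑ t_α a_α. Averaging
φ(s (b y)_α) over y ∈ U gives 0 unless b vanishes on the arm of α, and gives φ(s b_α) if it does.
This average therefore replaces the condition "the conjugate lies in V_α" in the induced character
(`inducedCharacter_baseChar`). The α-entry of x (g - 1) y involves only row `α.row` of x and column
`α.col` of y. As D has distinct rows and distinct columns, a product of averages is the average of a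
product (`prod_average`), so ξ_D(g) is q^N times the average over x, y of φ(λ_D(x (g - 1) y)), where
N is the total size of the arms (`supercharacter_apply`).

Orthogonality of additive characters turns the inner product into a count of pairs (x, y) with λ_D(x
a) = λ_{D'}(a y) for all strictly upper triangular a (`charInner_supercharacter`). Comparing
coefficients of a gives equations in which each side has at most one nonzero term. A solution forces
D = D' and equal coefficients (`EntriesAgree.eq`). If they are equal, x ranges over V_D R_D, and x
determines y exactly on the legs (the positions below the roots of D in their columns, above the
diagonal), leaving |V_D| choices (`entriesAgree_self_iff`). Since |U| = |V_D| q^N, the normalized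
count is the index. -/

/-! ### Coordinates on the unitriangular group -/

section Coordinates

variable {n : ℕ} {F : Type*} [Field F]

/-- The strictly upper triangular matrix with prescribed entries above the diagonal. -/
def strictMatrix : (PosRoot n → F) →ₗ[F] Matrix (Fin n) (Fin n) F where
  toFun f := Matrix.of fun i j => if h : i < j then f ⟨i, j, h⟩ else 0
  map_add' f g := by
    ext i j
    by_cases h : i < j <;> simp [h]
  map_smul' c f := by
    ext i j
    by_cases h : i < j <;> simp [h]

theorem strictMatrix_apply (f : PosRoot n → F) (i j : Fin n) :
    strictMatrix f i j = if h : i < j then f ⟨i, j, h⟩ else 0 := rfl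

theorem strictMatrix_root (f : PosRoot n → F) (β : PosRoot n) :
    strictMatrix f β.row β.col = f β := by
  rw [strictMatrix_apply, dif_pos β.row_lt_col]

theorem strictMatrix_eq_of_forall {a : Matrix (Fin n) (Fin n) F} (h : ∀ i j, j ≤ i → a i j = 0) :
    strictMatrix (fun β => a β.row β.col) = a := by
  ext i j
  rw [strictMatrix_apply]
  split_ifs with hij
  · rfl
  · exact (h i j (not_lt.1 hij)).symm

/-- An upper triangular matrix with ones on the diagonal, as an element of `U_n(F)`. -/
noncomputable def unitriangularMk (a : Matrix (Fin n) (Fin n) F) (h1 : ∀ i, a i i = 1)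
    (h0 : ∀ i j, j < i → a i j = 0) : unitriangular n F :=
  ⟨Matrix.GeneralLinearGroup.mkOfDetNeZero a (by
    rw [Matrix.det_of_isUpperTriangular (fun i j h => h0 i j h)]
    simp [h1]), h1, h0⟩

theorem unitriangularMk_val (a : Matrix (Fin n) (Fin n) F) (h1 : ∀ i, a i i = 1)
    (h0 : ∀ i j, j < i → a i j = 0) : (unitriangularMk a h1 h0).val.val = a := rfl

theorem unitriangular_ext {x y : unitriangular n F}
    (h : ∀ β : PosRoot n, x.val.val β.row β.col = y.val.val β.row β.col) : x = y := by
  apply Subtype.ext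
  apply Units.ext
  ext i j
  rcases lt_trichotomy i j with hij | rfl | hij
  · exact h ⟨i, j, hij⟩
  · rw [x.2.1, y.2.1]
  · rw [x.2.2 i j hij, y.2.2 i j hij]

/-- `U_n(F)` is parametrized by the entries above the diagonal. -/
noncomputable def unitriangularEquiv (n : ℕ) (F : Type*) [Field F] :
    unitriangular n F ≃ (PosRoot n → F) where
  toFun x β := x.val.val β.row β.col
  invFun f := unitriangularMk (1 + strictMatrix f) (fun i => by simp [strictMatrix_apply])
    (fun i j h => by simp [strictMatrix_apply, h.not_gt, h.ne'])
  left_inv x := unitriangular_ext fun β => by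
    rw [unitriangularMk_val, Matrix.add_apply, strictMatrix_root,
      Matrix.one_apply_ne β.row_lt_col.ne, zero_add]
  right_inv f := by
    funext β
    change (1 + strictMatrix f) β.row β.col = f β
    rw [Matrix.add_apply, strictMatrix_root,
      Matrix.one_apply_ne β.row_lt_col.ne, zero_add]

theorem unitriangularEquiv_symm_val (f : PosRoot n → F) :
    ((unitriangularEquiv n F).symm f).val.val = 1 + strictMatrix f := rfl

theorem strictMatrix_unitriangularEquiv (x : unitriangular n F) :
    strictMatrix (unitriangularEquiv n F x) = x.val.val - 1 := by
  rw [eq_sub_iff_add_eq', ← unitriangularEquiv_symm_val, Equiv.symm_apply_apply]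

theorem unitriangular_inv_mul_val (x : unitriangular n F) : x⁻¹.val.val * x.val.val = 1 := by
  rw [← Units.val_mul, ← Subgroup.coe_mul, inv_mul_cancel]
  rfl

theorem unitriangular_mul_inv_val (x : unitriangular n F) : x.val.val * x⁻¹.val.val = 1 := by
  rw [← Units.val_mul, ← Subgroup.coe_mul, mul_inv_cancel]
  rfl

theorem unitriangular_mul_val (x y : unitriangular n F) :
    (x * y).val.val = x.val.val * y.val.val := rfl

theorem strictUpper_mul_mul {a : Matrix (Fin n) (Fin n) F} (h : ∀ i j, j ≤ i → a i j = 0)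
    (x y : unitriangular n F) : ∀ i j, j ≤ i → (x.val.val * a * y.val.val) i j = 0 := by
  intro i j hij
  rw [Matrix.mul_apply]
  refine Finset.sum_eq_zero fun l _ => ?_
  rcases lt_or_ge j l with hl | hl
  · rw [y.2.2 l j hl, mul_zero]
  rw [Matrix.mul_apply, Finset.sum_eq_zero, zero_mul]
  intro k _
  rcases lt_or_ge k i with hk | hk
  · rw [x.2.2 i k hk, zero_mul]
  · rw [h k l (hl.trans (hij.trans hk)), mul_zero]

theorem strictUpper_sub_one (x : unitriangular n F) :
    ∀ i j, j ≤ i → (x.val.val - 1) i j = 0 := by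
  intro i j hij
  rw [Matrix.sub_apply]
  rcases hij.lt_or_eq with h | rfl
  · rw [x.2.2 i j h, Matrix.one_apply_ne h.ne', sub_zero]
  · rw [x.2.1, Matrix.one_apply_eq, sub_self]

instance : Finite (PosRoot n) :=
  Finite.of_injective (fun β : PosRoot n => (β.row, β.col)) fun _ _ h =>
    PosRoot.ext (congrArg Prod.fst h) (congrArg Prod.snd h)

open Classical in
/-- The number of elements of `U_n(F)` with prescribed entries at finitely many positions. -/
theorem card_prescribed_mul [Fintype F] {ι : Type*} [Fintype ι] (e : ι → PosRoot n)
    (he : Function.Injective e) (p : ι → F) :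
    (Finset.univ.filter fun x : unitriangular n F =>
        ∀ q, x.val.val (e q).row (e q).col = p q).card * Fintype.card F ^ Fintype.card ι =
      Fintype.card (unitriangular n F) := by
  have : Fintype (PosRoot n) := Fintype.ofFinite _
  let r : (PosRoot n → F) →+ (ι → F) :=
    { toFun := fun f => f ∘ e, map_zero' := rfl, map_add' := fun _ _ => rfl }
  have hr : Function.Surjective r := he.surjective_comp_right
  -- `r` is a surjective homomorphism, so its fibres are cosets of one kernel and have equal size.
  have hfib : ∀ p' : ι → F, (Finset.univ.filter fun f => r f = p').card =
      (Finset.univ.filter fun f => r f = p).card := fun p' =>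
    AddMonoidHom.card_fiber_eq_of_mem_range r (hr p') (hr p)
  have htot : Fintype.card (PosRoot n → F) =
      (Finset.univ.filter fun f => r f = p).card * Fintype.card (ι → F) := by
    rw [← Finset.card_univ, Finset.card_eq_sum_card_fiberwise (f := r) (t := Finset.univ)
      (fun _ _ => Finset.mem_univ _), Finset.sum_congr rfl fun p' _ => hfib p',
      Finset.sum_const, smul_eq_mul, Finset.card_univ, mul_comm]
  rw [Fintype.card_congr (unitriangularEquiv n F), htot, Fintype.card_fun]
  congr 1
  refine Finset.card_equiv (unitriangularEquiv n F) fun x => ?_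
  simp only [Finset.mem_filter, Finset.mem_univ, true_and]
  exact funext_iff.symm

end Coordinates

/-! ### Pattern subgroups -/

section PatternSubgroups

variable {n : ℕ} {F : Type*} [Field F]

theorem rootGenerated_mono {S T : Set (PosRoot n)} (h : S ⊆ T) :
    rootGenerated F S ≤ rootGenerated F T :=
  biSup_mono h

theorem rootElem_mem_rootGenerated {S : Set (PosRoot n)} {β : PosRoot n} (h : β ∈ S)
    (c : Multiplicative F) : rootElem β c ∈ rootGenerated F S :=
  le_iSup₂_of_le (f := fun γ (_ : γ ∈ S) => rootSubgroup F γ) β h le_rfl ⟨c, rfl⟩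

theorem rootElem_mul_val (β : PosRoot n) (c : F) (x : unitriangular n F) (i j : Fin n) :
    (rootElem β (Multiplicative.ofAdd c) * x).val.val i j =
      x.val.val i j + if β.row = i then c * x.val.val β.col j else 0 := by
  change (Matrix.transvection β.row β.col c * x.val.val) i j = _
  split_ifs with h
  · rw [← h, Matrix.transvection_mul_apply_same]
  · rw [Matrix.transvection_mul_apply_of_ne _ _ _ _ (Ne.symm h), add_zero]

/-- Every element of `U_n(F)` is a product of root elements in its support. -/
theorem mem_rootGenerated_support (x : unitriangular n F) :
    x ∈ rootGenerated F {β : PosRoot n | x.val.val β.row β.col ≠ 0} := by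
  classical
  have : Fintype (PosRoot n) := Fintype.ofFinite _
  suffices H : ∀ (m : ℕ) (x : unitriangular n F),
      (Finset.univ.filter fun β : PosRoot n => x.val.val β.row β.col ≠ 0).card = m →
      x ∈ rootGenerated F {β : PosRoot n | x.val.val β.row β.col ≠ 0} from H _ x rfl
  intro m
  induction m with
  | zero =>
    intro x hx
    rw [Finset.card_eq_zero, Finset.filter_eq_empty_iff] at hx
    have : x = 1 := unitriangular_ext fun β => by
      rw [not_not.1 (hx (Finset.mem_univ β))]
      exact (Matrix.one_apply_ne β.row_lt_col.ne).symm
    rw [this]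
    exact one_mem _
  | succ m ih =>
    intro x hx
    have hne : (Finset.univ.filter fun β : PosRoot n => x.val.val β.row β.col ≠ 0).Nonempty := by
      rw [← Finset.card_pos, hx]
      exact m.succ_pos
    -- With β in the lowest occupied row, row `β.col` of x is that of the identity. Subtracting c
    -- times it from row `β.row` kills the entry at β and changes nothing else.
    obtain ⟨β, hβ, hmax⟩ := Finset.exists_max_image _ (fun β : PosRoot n => β.row) hne
    simp only [Finset.mem_filter, Finset.mem_univ, true_and] at hβ hmax
    set c := x.val.val β.row β.col with hc
    set y := rootElem β (Multiplicative.ofAdd (-c)) * x with hy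
    have hyval : ∀ γ : PosRoot n, y.val.val γ.row γ.col =
        if γ = β then 0 else x.val.val γ.row γ.col := by
      intro γ
      rw [hy, rootElem_mul_val]
      split_ifs with h1 h2 h2
      · rw [h2, x.2.1]
        ring
      · have hcol : γ.col ≠ β.col := fun h => h2 (PosRoot.ext h1.symm h)
        rcases lt_or_gt_of_ne hcol with h | h
        · rw [x.2.2 _ _ h]
          ring
        · have : x.val.val β.col γ.col = 0 := by
            by_contra h0
            exact absurd (hmax ⟨β.col, γ.col, h⟩ h0) (not_le.2 β.row_lt_col)
          rw [this]
          ring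
      · exact absurd (congrArg PosRoot.row h2).symm h1
      · rw [add_zero]
    have hycard : (Finset.univ.filter fun γ : PosRoot n => y.val.val γ.row γ.col ≠ 0).card = m := by
      have : (Finset.univ.filter fun γ : PosRoot n => y.val.val γ.row γ.col ≠ 0) =
          (Finset.univ.filter fun γ : PosRoot n => x.val.val γ.row γ.col ≠ 0).erase β := by
        ext γ
        simp [hyval]
      rw [this, Finset.card_erase_of_mem (by simpa using hβ), hx, Nat.add_sub_cancel]
    have hymem := rootGenerated_mono (F := F)
      (T := {β : PosRoot n | x.val.val β.row β.col ≠ 0}) (fun γ hγ => by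
        rw [Set.mem_ofPred_eq, hyval] at hγ
        split_ifs at hγ with h
        · exact absurd rfl hγ
        · exact hγ) (ih y hycard)
    have hx' : x = (rootElem β (Multiplicative.ofAdd (-c)))⁻¹ * y := by
      rw [hy, inv_mul_cancel_left]
    rw [hx']
    refine mul_mem (inv_mem (rootElem_mem_rootGenerated ?_ _)) ?_
    · rw [← hx']
      exact hβ
    · rw [← hx']
      exact hymem

theorem mem_rootGenerated_of_support {J : Set (PosRoot n)} {x : unitriangular n F}
    (h : ∀ β : PosRoot n, x.val.val β.row β.col ≠ 0 → β ∈ J) : x ∈ rootGenerated F J :=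
  rootGenerated_mono (F := F) h (mem_rootGenerated_support x)

/-- For a closed set of roots `J`, the root subgroups in `J` generate the pattern subgroup of `J`. -/
theorem mem_rootGenerated_iff {J : Set (PosRoot n)}
    (hJ : ∀ α ∈ J, ∀ β ∈ J, ∀ γ : PosRoot n,
      α.col = β.row → γ.row = α.row → γ.col = β.col → γ ∈ J) {x : unitriangular n F} :
    x ∈ rootGenerated F J ↔ ∀ β ∉ J, x.val.val β.row β.col = 0 := by
  refine ⟨fun hx => ?_, fun h => mem_rootGenerated_of_support fun β hβ => ?_⟩
  · unfold rootGenerated at hx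
    rw [iSup_subtype'] at hx
    refine Subgroup.iSup_induction _ (C := fun y : unitriangular n F =>
      ∀ β ∉ J, y.val.val β.row β.col = 0) hx ?_ ?_ ?_
    · rintro ⟨γ, hγ⟩ _ ⟨c, rfl⟩ β hβ
      have : ¬ (γ.row = β.row ∧ γ.col = β.col) := fun h => hβ (PosRoot.ext h.1 h.2 ▸ hγ)
      rw [rootElem_val, if_neg this, add_zero, Matrix.one_apply_ne β.row_lt_col.ne]
    · exact fun β _ => Matrix.one_apply_ne β.row_lt_col.ne
    · intro x y hx hy β hβ
      rw [unitriangular_mul_val, Matrix.mul_apply]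
      refine Finset.sum_eq_zero fun k _ => ?_
      rcases lt_trichotomy β.row k with h1 | rfl | h1
      · rcases lt_trichotomy k β.col with h2 | rfl | h2
        · by_cases hx0 : (⟨β.row, k, h1⟩ : PosRoot n) ∈ J
          · rw [hy ⟨k, β.col, h2⟩ fun hy0 => hβ (hJ _ hx0 _ hy0 β rfl rfl rfl), mul_zero]
          · rw [hx ⟨β.row, k, h1⟩ hx0, zero_mul]
        · rw [hx β hβ, zero_mul]
        · rw [y.2.2 _ _ h2, mul_zero]
      · rw [hy β hβ, mul_zero]
      · rw [x.2.2 _ _ h1, zero_mul]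
  · by_contra h'
    exact hβ (h β h')

theorem mem_baseGroup_iff {α : PosRoot n} {x : unitriangular n F} :
    x ∈ baseGroup F α ↔ ∀ k, α.row < k → k < α.col → x.val.val α.row k = 0 := by
  refine ⟨entry_eq_zero_of_mem_baseGroup, fun h =>
    mem_rootGenerated_of_support fun β hβ hβ' => hβ ?_⟩
  have hrow : β.row = α.row := hβ'.1
  rw [hrow]
  exact h _ (hrow ▸ β.row_lt_col) hβ'.2

theorem mem_VD_iff {D : Finset (PosRoot n)} {x : unitriangular n F} :
    x ∈ VD F D ↔ ∀ α ∈ D, ∀ k, α.row < k → k < α.col → x.val.val α.row k = 0 := by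
  simp only [VD, Subgroup.mem_iInf, mem_baseGroup_iff]

/-- On arms of a basic set, membership in `Γ_D` only involves the root with the given arm. -/
theorem mem_GammaD_iff_of_mem_arm {D : Finset (PosRoot n)} (hD : IsBasic D) {α γ : PosRoot n}
    (hα : α ∈ D) (hγ : γ ∈ α.arm) :
    γ ∈ GammaD D ↔ ∃ β ∈ D, β.row = γ.col ∧ α.col < β.col := by
  constructor
  · rintro ⟨τ, hτ, β, hβ, h1, -, h3, h4⟩
    have : τ = α := by
      by_contra hne
      exact (hD.2 τ hτ α hα hne).1 (h3.symm.trans hγ.1)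
    exact ⟨β, hβ, h4.symm, this ▸ h1⟩
  · rintro ⟨β, hβ, h1, h2⟩
    refine ⟨α, hα, β, hβ, h2, ?_, hγ.1, h1.symm⟩
    rw [h1, ← show γ.row = α.row from hγ.1]
    exact γ.row_lt_col

/-- Membership in `V_D R_D` in terms of matrix entries. -/
theorem mem_VD_sup_RD_iff {D : Finset (PosRoot n)} (hD : IsBasic D) {x : unitriangular n F} :
    x ∈ VD F D ⊔ RD F D ↔ ∀ α ∈ D, ∀ k, α.row < k → k < α.col →
      (¬ ∃ β ∈ D, β.row = k ∧ α.col < β.col) → x.val.val α.row k = 0 := by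
  -- K consists of Γ_D and all roots lying on no arm of D; these generate R_D and V_D together.
  set K : Set (PosRoot n) := {γ | ∀ α ∈ D, γ ∈ α.arm → γ ∈ GammaD D} with hK
  have hclosed : ∀ α ∈ K, ∀ β ∈ K, ∀ γ : PosRoot n,
      α.col = β.row → γ.row = α.row → γ.col = β.col → γ ∈ K := by
    -- If c = a + b lies on the arm of τ, so does a; as a ∈ Γ_D, some σ ∈ D in the row of b ends to
    -- the right of τ. Then b lies on the arm of σ, and the root ρ that it yields shows c ∈ Γ_D.
    intro a ha b hb c hab hca hcb τ hτ hc
    have hbτ : b.col < τ.col := hcb ▸ hc.2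
    have haτ : a ∈ τ.arm := ⟨hca ▸ hc.1, hab ▸ b.row_lt_col.trans hbτ⟩
    obtain ⟨σ, hσ, hσa, hσc⟩ := (mem_GammaD_iff_of_mem_arm hD hτ haτ).1 (ha τ hτ haτ)
    have hbσ : b ∈ σ.arm := ⟨hab ▸ hσa.symm, hbτ.trans hσc⟩
    obtain ⟨ρ, hρ, hρb, hρc⟩ := (mem_GammaD_iff_of_mem_arm hD hσ hbσ).1 (hb σ hσ hbσ)
    exact (mem_GammaD_iff_of_mem_arm hD hτ hc).2 ⟨ρ, hρ, hρb.trans hcb.symm, hσc.trans hρc⟩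
  have hgen : VD F D ⊔ RD F D = rootGenerated F K := by
    refine le_antisymm (sup_le (fun y hy => ?_) (rootGenerated_mono fun γ hγ _ _ _ => hγ)) ?_
    · refine mem_rootGenerated_of_support fun β hβ α hα hβ' => absurd ?_ hβ
      have hrow : β.row = α.row := hβ'.1
      rw [hrow]
      exact mem_VD_iff.1 hy α hα _ (hrow ▸ β.row_lt_col) hβ'.2
    · refine iSup₂_le fun γ hγ => ?_
      by_cases hγ' : γ ∈ GammaD D
      · exact le_sup_of_le_right
          (le_iSup₂_of_le (f := fun γ (_ : γ ∈ GammaD D) => rootSubgroup F γ) γ hγ' le_rfl)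
      · exact le_sup_of_le_left
          (le_iInf₂ fun α hα => rootSubgroup_le_baseGroup fun h => hγ' (hγ α hα h))
  rw [hgen, mem_rootGenerated_iff hclosed]
  constructor
  · intro h α hα k hk hk' hβ
    have harm : (⟨α.row, k, hk⟩ : PosRoot n) ∈ α.arm := ⟨rfl, hk'⟩
    exact h ⟨α.row, k, hk⟩ fun hmem =>
      hβ ((mem_GammaD_iff_of_mem_arm hD hα harm).1 (hmem α hα harm))
  · intro h γ hγ
    by_contra h0
    refine hγ fun α hα harm => (mem_GammaD_iff_of_mem_arm hD hα harm).2 ?_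
    have hrow : γ.row = α.row := harm.1
    by_contra hβ
    exact h0 (hrow ▸ h α hα _ (hrow ▸ γ.row_lt_col) harm.2 hβ)

/-- A linear character `λ_{α,s}` is determined on `V_α` by the entry at `α`. -/
theorem IsBaseChar.apply {φ : AddChar F ℂ} {α : PosRoot n} {s : F} {l : baseGroup F α →* ℂˣ}
    (hl : IsBaseChar φ α s l) (x : baseGroup F α) :
    ((l x : ℂˣ) : ℂ) = φ (x.1.val.val α.row α.col * s) := by
  obtain ⟨x, hx⟩ := x
  -- Membership is carried inside the statement, so that the induction can run over elements of U.
  suffices H : ∃ h : x ∈ baseGroup F α,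
      ((l ⟨x, h⟩ : ℂˣ) : ℂ) = φ (x.val.val α.row α.col * s) from H.2
  have hx' := hx
  unfold baseGroup rootGenerated at hx'
  rw [iSup_subtype'] at hx'
  refine Subgroup.iSup_induction _ (C := fun y : unitriangular n F =>
    ∃ h : y ∈ baseGroup F α, ((l ⟨y, h⟩ : ℂˣ) : ℂ) = φ (y.val.val α.row α.col * s)) hx' ?_ ?_ ?_
  · rintro ⟨β, hβ⟩ _ ⟨c, rfl⟩
    refine ⟨rootElem_mem_rootGenerated hβ c, ?_⟩
    rw [rootElem_val, Matrix.one_apply_ne α.row_lt_col.ne, zero_add]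
    by_cases h : β = α
    · subst h
      rw [if_pos ⟨rfl, rfl⟩]
      exact hl.1 c.toAdd _
    · rw [if_neg fun h' => h (PosRoot.ext h'.1 h'.2), zero_mul, AddChar.map_zero_eq_one,
        hl.2 β h (rootSubgroup_le_baseGroup hβ) _ ⟨c, rfl⟩, Units.val_one]
  · refine ⟨one_mem _, ?_⟩
    have h0 : (1 : unitriangular n F).val.val α.row α.col = 0 :=
      Matrix.one_apply_ne α.row_lt_col.ne
    rw [h0, zero_mul, AddChar.map_zero_eq_one]
    exact congrArg Units.val (map_one l)
  · rintro y z ⟨hy, hy'⟩ ⟨hz, hz'⟩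
    refine ⟨mul_mem hy hz, ?_⟩
    rw [mul_entry_of_arm_eq_zero _ _ _ _ (entry_eq_zero_of_mem_baseGroup hy) α.row_lt_col,
      add_mul, AddChar.map_add_eq_mul, ← hy', ← hz', ← Units.val_mul, ← map_mul]
    rfl

end PatternSubgroups

/-! ### Averages over the unitriangular group -/

section Averages

variable {n : ℕ} {F : Type*} [Field F]

open Classical in
/-- The element with the entries of `y` at positions in `S` and the entries of `x` elsewhere. -/
noncomputable def mixEntries (S : Fin n → Fin n → Prop) (x y : unitriangular n F) :
    unitriangular n F :=
  unitriangularMk (Matrix.of fun i j => if S i j then y.val.val i j else x.val.val i j)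
    (fun i => by simp [x.2.1, y.2.1])
    (fun i j h => by simp [x.2.2 i j h, y.2.2 i j h])

theorem mixEntries_of_mem {S : Fin n → Fin n → Prop} (x y : unitriangular n F) {i j : Fin n}
    (h : S i j) : (mixEntries S x y).val.val i j = y.val.val i j :=
  if_pos h

theorem mixEntries_of_notMem {S : Fin n → Fin n → Prop} (x y : unitriangular n F) {i j : Fin n}
    (h : ¬ S i j) : (mixEntries S x y).val.val i j = x.val.val i j :=
  if_neg h

theorem mixEntries_mixEntries (S : Fin n → Fin n → Prop) (x y : unitriangular n F) :
    mixEntries S (mixEntries S x y) (mixEntries S y x) = x := by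
  refine unitriangular_ext fun β => ?_
  by_cases h : S β.row β.col
  · rw [mixEntries_of_mem _ _ h, mixEntries_of_mem _ _ h]
  · rw [mixEntries_of_notMem _ _ h, mixEntries_of_notMem _ _ h]

/-- The function `f` only depends on the entries at positions in `S`. -/
def DependsOnEntries (S : Fin n → Fin n → Prop) (f : unitriangular n F → ℂ) : Prop :=
  ∀ x y : unitriangular n F, (∀ i j, S i j → x.val.val i j = y.val.val i j) → f x = f y

/-- Entries above the diagonal can be chosen independently, so f and g behave like independent
random variables. -/
theorem DependsOnEntries.sum_mul_sum [Finite F] {S : Fin n → Fin n → Prop}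
    {f g : unitriangular n F → ℂ} (hf : DependsOnEntries S f)
    (hg : DependsOnEntries (fun i j => ¬ S i j) g) :
    (∑ x, f x) * ∑ x, g x = Fintype.card (unitriangular n F) * ∑ x, f x * g x := by
  -- Exchanging the S-entries of the two components is an involution of U × U; afterwards the second
  -- component carries all that f and g depend on.
  let e : unitriangular n F × unitriangular n F ≃ unitriangular n F × unitriangular n F :=
    { toFun := fun p => (mixEntries S p.1 p.2, mixEntries S p.2 p.1)
      invFun := fun p => (mixEntries S p.1 p.2, mixEntries S p.2 p.1)
      left_inv := fun p => Prod.ext (mixEntries_mixEntries S _ _) (mixEntries_mixEntries S _ _)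
      right_inv := fun p => Prod.ext (mixEntries_mixEntries S _ _) (mixEntries_mixEntries S _ _) }
  rw [Fintype.sum_mul_sum, ← Fintype.sum_prod_type']
  have : ∀ p : unitriangular n F × unitriangular n F, f p.1 * g p.2 = f (e p).2 * g (e p).2 := by
    intro p
    rw [hf p.1 (e p).2 fun i j h => (mixEntries_of_mem _ _ h).symm,
      hg p.2 (e p).2 fun i j h => (mixEntries_of_notMem _ _ h).symm]
  rw [Finset.sum_congr rfl fun p _ => this p, Equiv.sum_comp e fun p => f p.2 * g p.2,
    Fintype.sum_prod_type]
  simp only [Finset.sum_const, Finset.card_univ, nsmul_eq_mul]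

/-- Averages of functions depending on disjoint sets of entries are multiplicative. -/
theorem prod_average [Finite F] {ι : Type*} (D : Finset ι) (S : ι → Fin n → Fin n → Prop)
    (h : ι → unitriangular n F → ℂ) (hS : ∀ α ∈ D, ∀ β ∈ D, α ≠ β → ∀ i j, S α i j → ¬ S β i j)
    (hh : ∀ α ∈ D, DependsOnEntries (S α) (h α)) :
    ∏ α ∈ D, ((Fintype.card (unitriangular n F) : ℂ)⁻¹ * ∑ x, h α x) =
      (Fintype.card (unitriangular n F) : ℂ)⁻¹ * ∑ x, ∏ α ∈ D, h α x := by
  classical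
  have hu : (Fintype.card (unitriangular n F) : ℂ) ≠ 0 := Nat.cast_ne_zero.2 Fintype.card_ne_zero
  induction D using Finset.induction_on with
  | empty => simp [hu]
  | insert a D ha ih =>
    have hmem : ∀ α ∈ D, α ≠ a := fun α hα h => ha (h ▸ hα)
    have key := DependsOnEntries.sum_mul_sum (hh a (Finset.mem_insert_self a D))
      (g := fun x => ∏ α ∈ D, h α x) fun x y hxy => Finset.prod_congr rfl fun α hα =>
        hh α (Finset.mem_insert_of_mem hα) x y fun i j hs => hxy i j
          (hS α (Finset.mem_insert_of_mem hα) a (Finset.mem_insert_self a D) (hmem α hα) i j hs)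
    rw [Finset.prod_insert ha, ih
      (fun α hα β hβ => hS α (Finset.mem_insert_of_mem hα) β (Finset.mem_insert_of_mem hβ))
      (fun α hα => hh α (Finset.mem_insert_of_mem hα)), mul_mul_mul_comm, key]
    simp only [Finset.prod_insert ha]
    field_simp

end Averages

/-! ### Elementary characters -/

section Elementary

variable {n : ℕ} {F : Type*} [Field F]

/-- Averaging `φ(s (b y)_α)` over `y` detects the vanishing of `b` on the arm of `α`. -/
theorem sum_addChar_mul_entry_eq_zero [Finite F] {φ : AddChar F ℂ} (hφ : φ ≠ 1) {s : F}
    (hs : s ≠ 0) (α : PosRoot n) (b : Matrix (Fin n) (Fin n) F) {k : Fin n} (hk : k < α.col)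
    (hbk : b α.row k ≠ 0) :
    ∑ y : unitriangular n F, φ (s * (b * y.val.val) α.row α.col) = 0 := by
  obtain ⟨d, hd⟩ := AddChar.ne_one_iff.1 hφ
  -- Left translation of y by z adds `b α.row k * c` to the entry, because y has ones on the
  -- diagonal. The value of c makes every summand acquire the factor φ(d) ≠ 1, so the sum vanishes.
  set c := (s * b α.row k)⁻¹ * d with hc
  set z : unitriangular n F := rootElem ⟨k, α.col, hk⟩ (Multiplicative.ofAdd c) with hz
  have hshift : ∀ y : unitriangular n F,
      φ (s * (b * (z * y).val.val) α.row α.col) =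
        φ d * φ (s * (b * y.val.val) α.row α.col) := by
    intro y
    rw [← AddChar.map_add_eq_mul]
    congr 1
    have h1 : (b * (z * y).val.val) α.row α.col =
        (b * y.val.val) α.row α.col + b α.row k * c := by
      simp only [Matrix.mul_apply, hz, rootElem_mul_val, mul_add, Finset.sum_add_distrib, mul_ite,
        mul_zero, Finset.sum_ite_eq, Finset.mem_univ, if_true, y.2.1, mul_one]
    rw [h1, hc]
    field_simp
    ring
  have key := Equiv.sum_comp (Equiv.mulLeft z)
    fun y : unitriangular n F => φ (s * (b * y.val.val) α.row α.col)
  simp only [Equiv.coe_mulLeft, hshift, ← Finset.mul_sum] at key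
  by_contra h0
  exact hd (mul_right_cancel₀ h0 (by rw [key, one_mul]))

theorem card_baseGroup_mul [Fintype F] (α : PosRoot n) :
    Nat.card (baseGroup F α) * Fintype.card F ^ (Finset.Ioo α.row α.col).card =
      Fintype.card (unitriangular n F) := by
  classical
  rw [← Fintype.card_coe (Finset.Ioo α.row α.col), ← card_prescribed_mul
    (fun k : Finset.Ioo α.row α.col => (⟨α.row, k, (Finset.mem_Ioo.1 k.2).1⟩ : PosRoot n))
    (fun k l h => Subtype.ext (congrArg PosRoot.col h)) 0]
  congr 1
  rw [Nat.card_eq_fintype_card, Fintype.card_subtype]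
  congr 1
  ext x
  simp [mem_baseGroup_iff]

/-- The elementary character `λ_{α,s}^U` as an average of additive characters. -/
theorem inducedCharacter_baseChar [Fintype F] {φ : AddChar F ℂ} (hφ : φ ≠ 1) {s : F} (hs : s ≠ 0)
    {α : PosRoot n} {l : baseGroup F α →* ℂˣ} (hl : IsBaseChar φ α s l) (g : unitriangular n F) :
    inducedCharacter (baseGroup F α) (fun x => ((l x : ℂˣ) : ℂ)) g =
      (Fintype.card F : ℂ) ^ (Finset.Ioo α.row α.col).card *
        ((Fintype.card (unitriangular n F) : ℂ)⁻¹ * ∑ x : unitriangular n F,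
          ((Fintype.card (unitriangular n F) : ℂ)⁻¹ * ∑ y : unitriangular n F,
            φ (s * (x.val.val * (g.val.val - 1) * y.val.val) α.row α.col))) := by
  classical
  set u : ℂ := ((Fintype.card (unitriangular n F) : ℕ) : ℂ) with hu
  have hu0 : u ≠ 0 := Nat.cast_ne_zero.2 Fintype.card_ne_zero
  have hterm : ∀ x : unitriangular n F,
      (if h : x⁻¹ * g * x ∈ baseGroup F α then ((l ⟨x⁻¹ * g * x, h⟩ : ℂˣ) : ℂ) else 0) =
        u⁻¹ * ∑ y : unitriangular n F,
          φ (s * (x⁻¹.val.val * (g.val.val - 1) * y.val.val) α.row α.col) := by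
    intro x
    set b := x⁻¹.val.val * (g.val.val - 1) * x.val.val with hb
    have hbx : (x⁻¹ * g * x).val.val = 1 + b := by
      rw [hb, unitriangular_mul_val, unitriangular_mul_val, mul_sub, sub_mul, mul_one,
        unitriangular_inv_mul_val, add_sub_cancel]
    have hb0 : ∀ i j, j ≤ i → b i j = 0 := strictUpper_mul_mul (strictUpper_sub_one g) _ _
    -- Replacing y by x y turns the one-sided factor x⁻¹ into a conjugation by x.
    have hreindex : ∑ y : unitriangular n F,
          φ (s * (x⁻¹.val.val * (g.val.val - 1) * y.val.val) α.row α.col) =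
        ∑ y : unitriangular n F, φ (s * (b * y.val.val) α.row α.col) := by
      rw [← Equiv.sum_comp (Equiv.mulLeft x)]
      simp only [Equiv.coe_mulLeft, unitriangular_mul_val, hb, mul_assoc]
    have hmem : x⁻¹ * g * x ∈ baseGroup F α ↔ ∀ k, α.row < k → k < α.col → b α.row k = 0 := by
      rw [mem_baseGroup_iff, hbx]
      refine forall_congr' fun k => forall_congr' fun hk => ?_
      rw [Matrix.add_apply, Matrix.one_apply_ne hk.ne, zero_add]
    rw [hreindex]
    split_ifs with h
    · rw [hl.apply, hbx, Matrix.add_apply, Matrix.one_apply_ne α.row_lt_col.ne, zero_add]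
      -- Since b vanishes on the arm and y is unitriangular, only the term `b α.row α.col` survives.
      have : ∀ y : unitriangular n F,
          (b * y.val.val) α.row α.col = b α.row α.col := by
        intro y
        rw [Matrix.mul_apply, Finset.sum_eq_single α.col, y.2.1, mul_one]
        · intro k _ hk
          rcases lt_or_gt_of_ne hk with hk | hk
          · rcases lt_or_ge α.row k with h' | h'
            · rw [hmem.1 h k h' hk, zero_mul]
            · rw [hb0 _ _ h', zero_mul]
          · rw [y.2.2 _ _ hk, mul_zero]
        · simp
      simp only [this, Finset.sum_const, Finset.card_univ, nsmul_eq_mul]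
      rw [← hu, inv_mul_cancel_left₀ hu0, mul_comm s]
    · rw [hmem] at h
      push Not at h
      obtain ⟨k, -, hk, hbk⟩ := h
      rw [sum_addChar_mul_entry_eq_zero hφ hs α b hk hbk, mul_zero]
  have hV : (Nat.card (baseGroup F α) : ℂ) *
      (Fintype.card F : ℂ) ^ (Finset.Ioo α.row α.col).card = u := by
    rw [hu, ← card_baseGroup_mul α]
    push_cast
    rfl
  have hV0 : (Nat.card (baseGroup F α) : ℂ) ≠ 0 := Nat.cast_ne_zero.2 Nat.card_pos.ne'
  have hq0 : (Fintype.card F : ℂ) ^ (Finset.Ioo α.row α.col).card ≠ 0 :=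
    pow_ne_zero _ (Nat.cast_ne_zero.2 Fintype.card_ne_zero)
  have hinv : (Nat.card (baseGroup F α) : ℂ)⁻¹ =
      (Fintype.card F : ℂ) ^ (Finset.Ioo α.row α.col).card * u⁻¹ := by
    rw [← hV]
    field_simp
  unfold inducedCharacter
  rw [Finset.sum_congr rfl fun x _ => hterm x, hinv, mul_assoc]
  congr 2
  exact Equiv.sum_comp (Equiv.inv _) fun x : unitriangular n F => u⁻¹ *
    ∑ y : unitriangular n F, φ (s * (x.val.val * (g.val.val - 1) * y.val.val) α.row α.col)

end Elementary

/-! ### Combinatorics of basic sets -/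

section Combinatorics

variable {n : ℕ} {F : Type*} [Field F]

theorem IsBasic.eq_of_row_eq {D : Finset (PosRoot n)} (hD : IsBasic D) {α β : PosRoot n}
    (hα : α ∈ D) (hβ : β ∈ D) (h : α.row = β.row) : α = β :=
  by_contra fun hne => (hD.2 α hα β hβ hne).1 h

theorem IsBasic.eq_of_col_eq {D : Finset (PosRoot n)} (hD : IsBasic D) {α β : PosRoot n}
    (hα : α ∈ D) (hβ : β ∈ D) (h : α.col = β.col) : α = β :=
  by_contra fun hne => (hD.2 α hα β hβ hne).2 h

/-- A column contains at most one root of D, which is why the sums in `EntriesAgree` collapse to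
single terms. -/
theorem IsBasic.sum_ite_col {D : Finset (PosRoot n)} (hD : IsBasic D) {α : PosRoot n}
    (hα : α ∈ D) (w : PosRoot n → F) :
    (∑ β ∈ D, if β.col = α.col then w β else 0) = w α := by
  rw [Finset.sum_eq_single α, if_pos rfl]
  · exact fun β hβ hne => if_neg fun h => hne (hD.eq_of_col_eq hβ hα h)
  · exact fun h => absurd hα h

theorem IsBasic.sum_ite_row {D : Finset (PosRoot n)} (hD : IsBasic D) {α : PosRoot n}
    (hα : α ∈ D) (w : PosRoot n → F) :
    (∑ β ∈ D, if β.row = α.row then w β else 0) = w α := by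
  rw [Finset.sum_eq_single α, if_pos rfl]
  · exact fun β hβ hne => if_neg fun h => hne (hD.eq_of_row_eq hβ hα h)
  · exact fun h => absurd hα h

theorem exists_of_sum_ite_ne_zero {D : Finset (PosRoot n)} {p : PosRoot n → Prop}
    [DecidablePred p] {w : PosRoot n → F} (h : (∑ β ∈ D, if p β then w β else 0) ≠ 0) :
    ∃ β ∈ D, p β ∧ w β ≠ 0 := by
  obtain ⟨β, hβ, h'⟩ := Finset.exists_ne_zero_of_sum_ne_zero h
  by_cases hp : p β
  · exact ⟨β, hβ, hp, by rwa [if_pos hp] at h'⟩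
  · exact absurd (if_neg hp) h'

/-- The equations expressing that two basic forms lie in the same double orbit. -/
def EntriesAgree (D D' : Finset (PosRoot n)) (t t' : PosRoot n → F) (x y : unitriangular n F) :
    Prop :=
  ∀ k l, k < l → (∑ α ∈ D, if α.col = l then t α * x.val.val α.row k else 0) =
    ∑ β ∈ D', if β.row = k then t' β * y.val.val l β.col else 0

/-- Basic forms in the same double orbit coincide. -/
theorem EntriesAgree.eq {D D' : Finset (PosRoot n)} (hD : IsBasic D) (hD' : IsBasic D')
    {t t' : PosRoot n → F} (ht : ∀ α ∈ D, t α ≠ 0) (ht' : ∀ α ∈ D', t' α ≠ 0)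
    {x y : unitriangular n F} (h : EntriesAgree D D' t t' x y) :
    D = D' ∧ ∀ α ∈ D, t α = t' α := by
  -- At position α the left side is t α ≠ 0, so D' has a root in that row, weakly to the right
  -- because y is upper triangular.
  have h1 : ∀ α ∈ D, ∃ β ∈ D', β.row = α.row ∧ α.col ≤ β.col ∧
      (α = β → t α = t' α) := by
    intro α hα
    have e := h α.row α.col α.row_lt_col
    rw [hD.sum_ite_col hα (fun β => t β * x.val.val β.row α.row), x.2.1, mul_one] at e
    obtain ⟨β, hβ, hr, hne⟩ := exists_of_sum_ite_ne_zero (e ▸ ht α hα)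
    refine ⟨β, hβ, hr, le_of_not_gt fun hlt => hne ?_, ?_⟩
    · rw [y.2.2 _ _ hlt, mul_zero]
    · rintro rfl
      rwa [hD'.sum_ite_row hβ (fun β => t' β * y.val.val α.col β.col), y.2.1, mul_one] at e
  -- Dually, at position β the right side is t' β ≠ 0.
  have h2 : ∀ β ∈ D', ∃ α ∈ D, α.col = β.col ∧ α.row ≤ β.row := by
    intro β hβ
    have e := h β.row β.col β.row_lt_col
    rw [hD'.sum_ite_row hβ (fun γ => t' γ * y.val.val β.col γ.col), y.2.1, mul_one] at e
    obtain ⟨α, hα, hc, hne⟩ := exists_of_sum_ite_ne_zero (e.symm ▸ ht' β hβ)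
    refine ⟨α, hα, hc, le_of_not_gt fun hlt => hne ?_⟩
    rw [x.2.2 _ _ hlt, mul_zero]
  -- Induction from the top row down. If β ∈ D' lay strictly right of α, the root γ ∈ D in the
  -- column of β would be either α itself or, lying higher, a second root of D' in that column.
  have key : ∀ (r : Fin n), ∀ α ∈ D, α.row = r → α ∈ D' ∧ t α = t' α := by
    intro r
    induction r using WellFoundedLT.induction with
    | ind r ih =>
      rintro α hα rfl
      obtain ⟨β, hβ, hrow, hcol, heq⟩ := h1 α hα
      rcases hcol.lt_or_eq with hlt | hc
      · obtain ⟨γ, hγ, hγc, hγr⟩ := h2 β hβ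
        rw [hrow] at hγr
        rcases hγr.lt_or_eq with hlt' | hr
        · have := hD'.eq_of_col_eq (ih _ hlt' γ hγ rfl).1 hβ hγc
          exact absurd (this ▸ hrow) hlt'.ne
        · have := hD.eq_of_row_eq hγ hα hr
          exact absurd (this ▸ hγc) hlt.ne
      · have : α = β := PosRoot.ext hrow.symm hc
        exact ⟨this ▸ hβ, heq this⟩
  refine ⟨Finset.Subset.antisymm (fun α hα => (key _ α hα rfl).1) fun β hβ => ?_,
    fun α hα => (key _ α hα rfl).2⟩
  obtain ⟨α, hα, hc, -⟩ := h2 β hβ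
  exact hD'.eq_of_col_eq (key _ α hα rfl).1 hβ hc ▸ hα

/-- The solutions of the double orbit equations for a single basic form. -/
theorem entriesAgree_self_iff {D : Finset (PosRoot n)} (hD : IsBasic D) {t : PosRoot n → F}
    (ht : ∀ α ∈ D, t α ≠ 0) {x y : unitriangular n F} :
    EntriesAgree D D t t x y ↔ x ∈ VD F D ⊔ RD F D ∧
      ∀ β ∈ D, ∀ l, β.row < l → l < β.col → y.val.val l β.col =
        (t β)⁻¹ * ∑ α ∈ D, if α.col = l then t α * x.val.val α.row β.row else 0 := by
  rw [mem_VD_sup_RD_iff hD]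
  constructor
  · intro h
    refine ⟨fun α hα k hk hk' hno => ?_, fun β hβ l hl _ => ?_⟩
    -- At (k, `α.col`) the left side is t α times the arm entry of x; a nonzero right side needs a
    -- root of D in row k ending to the right of α.
    · have e := h k α.col hk'
      rw [hD.sum_ite_col hα (fun β => t β * x.val.val β.row k)] at e
      by_contra h0
      obtain ⟨β, hβ, hr, hne⟩ := exists_of_sum_ite_ne_zero (e ▸ mul_ne_zero (ht α hα) h0)
      have hle : α.col ≤ β.col := le_of_not_gt fun hlt => hne (by rw [y.2.2 _ _ hlt, mul_zero])
      rcases hle.lt_or_eq with hlt | hc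
      · exact hno ⟨β, hβ, hr, hlt⟩
      · exact hk.ne ((congrArg PosRoot.row (hD.eq_of_col_eq hα hβ hc)).trans hr)
    · rw [h β.row l hl, hD.sum_ite_row hβ (fun γ => t γ * y.val.val l γ.col),
        inv_mul_cancel_left₀ (ht β hβ)]
  · rintro ⟨hx, hy⟩ k l hkl
    -- Either α is above row k and x vanishes there by hypothesis, or α is below row k and x is
    -- upper triangular.
    have hleft : ∀ α ∈ D, α.col = l → α.row ≠ k → (∀ β ∈ D, β.row = k → ¬ l < β.col) →
        t α * x.val.val α.row k = 0 := by
      rintro α hα rfl hne hno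
      rcases lt_or_gt_of_ne hne with h | h
      · rw [hx α hα k h hkl fun ⟨β, hβ, h1, h2⟩ => hno β hβ h1 h2, mul_zero]
      · rw [x.2.2 _ _ h, mul_zero]
    -- For β in row k, the equation prescribes the leg entry of y if l < `β.col`, reads t β = t β if
    -- l = `β.col`, and is 0 = 0 beyond. With no root in row k both sides vanish.
    by_cases hk : ∃ β ∈ D, β.row = k
    · obtain ⟨β, hβ, rfl⟩ := hk
      rw [hD.sum_ite_row hβ (fun γ => t γ * y.val.val l γ.col)]
      rcases lt_trichotomy l β.col with hl | rfl | hl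
      · rw [hy β hβ l hkl hl, mul_inv_cancel_left₀ (ht β hβ)]
      · rw [hD.sum_ite_col hβ (fun γ => t γ * x.val.val γ.row β.row), x.2.1, y.2.1]
      · rw [y.2.2 _ _ hl, mul_zero]
        refine Finset.sum_eq_zero fun α hα => ?_
        split_ifs with hc
        · refine hleft α hα hc (fun hr => ?_) fun γ hγ hr => ?_
          · exact hl.ne ((congrArg PosRoot.col (hD.eq_of_row_eq hα hβ hr)).symm.trans hc)
          · rw [hD.eq_of_row_eq hγ hβ hr]
            exact hl.not_gt
        · rfl
    · rw [Finset.sum_eq_zero fun α hα => ?_, Finset.sum_eq_zero fun β hβ => ?_]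
      · exact if_neg fun h => hk ⟨β, hβ, h⟩
      · split_ifs with hc
        · exact hleft α hα hc (fun h => hk ⟨α, hα, h⟩) fun β hβ h => absurd ⟨β, hβ, h⟩ hk
        · rfl

/-! ### Counting elements with prescribed arms or legs -/

theorem card_VD_mul [Fintype F] {D : Finset (PosRoot n)} (hD : IsBasic D) :
    Nat.card (VD F D) * Fintype.card F ^ (∑ α ∈ D, (Finset.Ioo α.row α.col).card) =
      Fintype.card (unitriangular n F) := by
  classical
  have hcard : Fintype.card (Σ α : D, Finset.Ioo α.1.row α.1.col) =
      ∑ α ∈ D, (Finset.Ioo α.row α.col).card := by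
    rw [Fintype.card_sigma, ← Finset.sum_coe_sort D]
    simp only [Fintype.card_coe]
  rw [← hcard, ← card_prescribed_mul
    (fun q : Σ α : D, Finset.Ioo α.1.row α.1.col =>
      (⟨q.1.1.row, q.2, (Finset.mem_Ioo.1 q.2.2).1⟩ : PosRoot n)) ?_ 0]
  · congr 1
    rw [Nat.card_eq_fintype_card, Fintype.card_subtype]
    congr 1
    ext x
    simp [mem_VD_iff, Sigma.forall]
  -- Arms of distinct roots of D lie in distinct rows, so no position is counted twice.
  · rintro ⟨⟨α, hα⟩, ⟨k, hk⟩⟩ ⟨⟨β, hβ⟩, ⟨l, hl⟩⟩ h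
    obtain ⟨hr, hc⟩ := PosRoot.ext_iff.1 h
    obtain rfl := hD.eq_of_row_eq hα hβ hr
    obtain rfl : k = l := hc
    rfl

-- A leg has as many positions as the arm of the same root, so prescribing all legs leaves as many
-- elements as V_D has.
open Classical in
theorem card_prescribed_legs_mul [Fintype F] {D : Finset (PosRoot n)} (hD : IsBasic D)
    (p : PosRoot n → Fin n → F) :
    (Finset.univ.filter fun y : unitriangular n F =>
        ∀ β ∈ D, ∀ l, β.row < l → l < β.col → y.val.val l β.col = p β l).card *
      Fintype.card F ^ (∑ α ∈ D, (Finset.Ioo α.row α.col).card) =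
      Fintype.card (unitriangular n F) := by
  have hcard : Fintype.card (Σ α : D, Finset.Ioo α.1.row α.1.col) =
      ∑ α ∈ D, (Finset.Ioo α.row α.col).card := by
    rw [Fintype.card_sigma, ← Finset.sum_coe_sort D]
    simp only [Fintype.card_coe]
  rw [← hcard, ← card_prescribed_mul
    (fun q : Σ α : D, Finset.Ioo α.1.row α.1.col =>
      (⟨q.2, q.1.1.col, (Finset.mem_Ioo.1 q.2.2).2⟩ : PosRoot n)) ?_ fun q => p q.1 q.2]
  · congr 2
    ext x
    simp [Sigma.forall]
  · rintro ⟨⟨α, hα⟩, ⟨k, hk⟩⟩ ⟨⟨β, hβ⟩, ⟨l, hl⟩⟩ h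
    obtain ⟨hr, hc⟩ := PosRoot.ext_iff.1 h
    obtain rfl := hD.eq_of_col_eq hα hβ hc
    obtain rfl : k = l := hr
    rfl

end Combinatorics

/-! ### Supercharacters and their inner products -/

section Forms

variable {n : ℕ} {F : Type*} [Field F]

/-- The linear form `a ↦ ∑_{α ∈ D} t_α a_α` on matrices. -/
def rootForm (D : Finset (PosRoot n)) (t : PosRoot n → F) : Matrix (Fin n) (Fin n) F →ₗ[F] F :=
  ∑ α ∈ D, t α • Matrix.entryLinearMap F F α.row α.col

theorem rootForm_apply (D : Finset (PosRoot n)) (t : PosRoot n → F)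
    (a : Matrix (Fin n) (Fin n) F) : rootForm D t a = ∑ α ∈ D, t α * a α.row α.col := by
  simp [rootForm]

theorem addChar_rootForm (φ : AddChar F ℂ) (D : Finset (PosRoot n)) (t : PosRoot n → F)
    (a : Matrix (Fin n) (Fin n) F) :
    φ (rootForm D t a) = ∏ α ∈ D, φ (t α * a α.row α.col) := by
  rw [rootForm_apply]
  exact map_prod φ.toMonoidHom (fun α : PosRoot n => Multiplicative.ofAdd (t α * a α.row α.col)) D

/-- The coefficients of the character choice in a basic pair. -/
theorem exists_coeff {φ : AddChar F ℂ} (P : BasicPair n φ) :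
    ∃ t : PosRoot n → F, (∀ α ∈ P.1.1, t α ≠ 0) ∧
      ∀ α : P.1.1, IsBaseChar φ α.1 (t α.1) (P.2 α).1 := by
  classical
  choose s hs hl using fun α : P.1.1 => (P.2 α).2
  refine ⟨fun α => if h : α ∈ P.1.1 then s ⟨α, h⟩ else 0, fun α hα => ?_, fun α => ?_⟩
  · simpa only [dif_pos hα] using hs _
  · simpa only [dif_pos α.2] using hl α

/-- The supercharacter as an average of additive characters. -/
theorem supercharacter_apply [Fintype F] {φ : AddChar F ℂ} (hφ : φ ≠ 1) (P : BasicPair n φ)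
    {t : PosRoot n → F} (ht : ∀ α ∈ P.1.1, t α ≠ 0)
    (hl : ∀ α : P.1.1, IsBaseChar φ α.1 (t α.1) (P.2 α).1) (g : unitriangular n F) :
    supercharacter P g =
      (Fintype.card F : ℂ) ^ (∑ α ∈ P.1.1, (Finset.Ioo α.row α.col).card) *
        ((Fintype.card (unitriangular n F) : ℂ)⁻¹ ^ 2 *
          ∑ p : unitriangular n F × unitriangular n F,
            φ (rootForm P.1.1 t (p.1.val.val * (g.val.val - 1) * p.2.val.val))) := by
  unfold supercharacter
  rw [Finset.prod_congr rfl fun α _ => inducedCharacter_baseChar hφ (ht α.1 α.2) (hl α) g,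
    Finset.prod_mul_distrib, Finset.prod_pow_eq_pow_sum,
    Finset.sum_coe_sort P.1.1 fun α => (Finset.Ioo α.row α.col).card,
    Finset.prod_coe_sort P.1.1 fun α => (Fintype.card (unitriangular n F) : ℂ)⁻¹ *
      ∑ x : unitriangular n F, ((Fintype.card (unitriangular n F) : ℂ)⁻¹ *
        ∑ y : unitriangular n F,
          φ (t α * (x.val.val * (g.val.val - 1) * y.val.val) α.row α.col))]
  congr 1
  -- The averages over x merge because the roots use distinct rows; those over y, below, because
  -- they use distinct columns.
  rw [prod_average P.1.1 (fun α i _ => i = α.row)]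
  · rw [Fintype.sum_prod_type, sq, mul_assoc]
    congr 1
    rw [Finset.mul_sum]
    refine Finset.sum_congr rfl fun x _ => ?_
    rw [prod_average P.1.1 (fun α _ j => j = α.col)]
    · simp only [addChar_rootForm]
    · intro α hα β hβ hne i j h h'
      exact (P.1.2.2 α hα β hβ hne).2 (h.symm.trans h')
    · intro α _ y y' h
      have : (x.val.val * (g.val.val - 1) * y.val.val) α.row α.col =
          (x.val.val * (g.val.val - 1) * y'.val.val) α.row α.col := by
        rw [Matrix.mul_apply, Matrix.mul_apply]
        exact Finset.sum_congr rfl fun k _ => by rw [h k _ rfl]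
      simp only [this]
  · intro α hα β hβ hne i j h h'
    exact (P.1.2.2 α hα β hβ hne).1 (h.symm.trans h')
  · intro α _ x x' h
    have : ∀ y : unitriangular n F,
        (x.val.val * (g.val.val - 1) * y.val.val) α.row α.col =
          (x'.val.val * (g.val.val - 1) * y.val.val) α.row α.col := by
      intro y
      rw [mul_assoc, mul_assoc, Matrix.mul_apply, Matrix.mul_apply]
      exact Finset.sum_congr rfl fun k _ => by rw [h _ k rfl]
    simp only [this]

/-- The forms `a ↦ λ_D(x a)` and `a ↦ λ_{D'}(a y)` agree on strictly upper triangular matrices. -/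
def FormsAgree (D D' : Finset (PosRoot n)) (t t' : PosRoot n → F) (x y : unitriangular n F) :
    Prop :=
  ∀ f : PosRoot n → F,
    rootForm D t (x.val.val * strictMatrix f) = rootForm D' t' (strictMatrix f * y.val.val)

/-- Both sides are linear in a; the equations compare the coefficients of the entries a_{kl} with k
< l, isolated by matrix units. -/
theorem formsAgree_iff {D D' : Finset (PosRoot n)} {t t' : PosRoot n → F}
    {x y : unitriangular n F} :
    FormsAgree D D' t t' x y ↔ EntriesAgree D D' t t' x y := by
  classical
  have h1 : ∀ a : Matrix (Fin n) (Fin n) F, rootForm D t (x.val.val * a) = ∑ k, ∑ l,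
      a k l * ∑ α ∈ D, if α.col = l then t α * x.val.val α.row k else 0 := by
    intro a
    simp only [rootForm_apply, Matrix.mul_apply, Finset.mul_sum]
    rw [Finset.sum_comm]
    refine Finset.sum_congr rfl fun k _ => ?_
    rw [Finset.sum_comm]
    refine Finset.sum_congr rfl fun α _ => ?_
    simp only [mul_ite, mul_zero, Finset.sum_ite_eq, Finset.mem_univ, if_true]
    ring
  have h2 : ∀ a : Matrix (Fin n) (Fin n) F, rootForm D' t' (a * y.val.val) = ∑ k, ∑ l,
      a k l * ∑ β ∈ D', if β.row = k then t' β * y.val.val l β.col else 0 := by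
    intro a
    simp only [rootForm_apply, Matrix.mul_apply, Finset.mul_sum]
    conv_rhs => rw [Finset.sum_comm]
    rw [Finset.sum_comm]
    refine Finset.sum_congr rfl fun l _ => ?_
    rw [Finset.sum_comm]
    refine Finset.sum_congr rfl fun β _ => ?_
    simp only [mul_ite, mul_zero, Finset.sum_ite_eq, Finset.mem_univ, if_true]
    ring
  constructor
  · intro h k l hkl
    have := h (Pi.single ⟨k, l, hkl⟩ 1)
    have hs : strictMatrix (Pi.single (⟨k, l, hkl⟩ : PosRoot n) (1 : F)) =
        Matrix.single k l 1 := by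
      ext i j
      rw [strictMatrix_apply, Matrix.single_apply]
      split_ifs with hij hkl' hkl'
      · obtain ⟨rfl, rfl⟩ := hkl'
        exact Pi.single_eq_same _ _
      · exact Pi.single_eq_of_ne
          (fun h => hkl' ⟨(congrArg PosRoot.row h).symm, (congrArg PosRoot.col h).symm⟩) _
      · exact absurd (hkl'.1 ▸ hkl'.2 ▸ hkl) hij
      · rfl
    rw [hs, h1, h2] at this
    have hsingle : ∀ w : Fin n → Fin n → F,
        ∑ i, ∑ j, (Matrix.single k l (1 : F)) i j * w i j = w k l := by
      intro w
      rw [Finset.sum_eq_single k, Finset.sum_eq_single l, Matrix.single_apply_same, one_mul]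
      · intro j _ hj
        rw [Matrix.single_apply_of_ne _ _ _ _ _ fun h => hj h.2.symm, zero_mul]
      · simp
      · intro i _ hi
        exact Finset.sum_eq_zero fun j _ => by
          rw [Matrix.single_apply_of_ne _ _ _ _ _ fun h => hi h.1.symm, zero_mul]
      · simp
    simpa only [hsingle] using this
  · intro h f
    rw [h1, h2]
    refine Finset.sum_congr rfl fun k _ => Finset.sum_congr rfl fun l _ => ?_
    by_cases hkl : k < l
    · rw [h k l hkl]
    · rw [strictMatrix_apply, dif_neg hkl, zero_mul, zero_mul]

open Classical in
/-- Orthogonality of additive characters on the strictly upper triangular matrices. -/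
theorem sum_addChar_linear [Finite F] {φ : AddChar F ℂ} (hφ : φ ≠ 1)
    (ℓ : Matrix (Fin n) (Fin n) F →ₗ[F] F) :
    ∑ g : unitriangular n F, φ (ℓ (g.val.val - 1)) =
      if ∀ f, ℓ (strictMatrix f) = 0 then (Fintype.card (unitriangular n F) : ℂ) else 0 := by
  have : Fintype (PosRoot n) := Fintype.ofFinite _
  have : Fintype F := Fintype.ofFinite _
  have hcard : Fintype.card (unitriangular n F) = Fintype.card (PosRoot n → F) :=
    Fintype.card_congr (unitriangularEquiv n F)
  let m : (PosRoot n → F) →ₗ[F] F := ℓ ∘ₗ strictMatrix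
  have hsum : ∑ g : unitriangular n F, φ (ℓ (g.val.val - 1)) =
      ∑ f, φ.compAddMonoidHom m.toAddMonoidHom f := by
    rw [← Equiv.sum_comp (unitriangularEquiv n F)]
    refine Finset.sum_congr rfl fun g _ => ?_
    rw [← strictMatrix_unitriangularEquiv]
    rfl
  rw [hsum, AddChar.sum_eq_ite, hcard]
  congr 1
  refine propext ⟨fun h f => ?_, fun h => ?_⟩
  · by_contra h0
    obtain ⟨d, hd⟩ := AddChar.ne_one_iff.1 hφ
    refine hd ?_
    -- A nonzero form takes every value; f is rescaled so that the value is d, where φ is not 1.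
    have h1 := DFunLike.congr_fun h ((d * (ℓ (strictMatrix f))⁻¹) • f)
    have h2 : m ((d * (ℓ (strictMatrix f))⁻¹) • f) = d := by
      change ℓ (strictMatrix _) = d
      rw [map_smul, map_smul, smul_eq_mul, inv_mul_cancel_right₀ h0]
    rw [← h2]
    exact h1
  · ext f
    change φ (ℓ (strictMatrix f)) = 1
    rw [h, AddChar.map_zero_eq_one]

/-- The substitution a ↦ x'⁻¹ a y⁻¹ permutes the strictly upper triangular matrices and moves all
factors to one side of a in each form. -/
theorem formsAgree_translate {D D' : Finset (PosRoot n)} {t t' : PosRoot n → F}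
    (x y x' y' : unitriangular n F) :
    (∀ f, (rootForm D t ∘ₗ LinearMap.mulLeftRight F (x.val.val, y.val.val) -
      rootForm D' t' ∘ₗ LinearMap.mulLeftRight F (x'.val.val, y'.val.val)) (strictMatrix f) = 0) ↔
      FormsAgree D D' t t' (x * x'⁻¹) (y⁻¹ * y') := by
  simp only [LinearMap.sub_apply, LinearMap.comp_apply, LinearMap.mulLeftRight_apply, sub_eq_zero,
    FormsAgree, unitriangular_mul_val]
  constructor
  · intro h f
    have hf : ∀ i j, j ≤ i → strictMatrix f i j = 0 := fun i j hij => by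
      rw [strictMatrix_apply, dif_neg (not_lt.2 hij)]
    have := h fun β => (x'⁻¹.val.val * strictMatrix f * y⁻¹.val.val) β.row β.col
    rw [strictMatrix_eq_of_forall (strictUpper_mul_mul hf _ _)] at this
    rw [show x.val.val * x'⁻¹.val.val * strictMatrix f =
        x.val.val * (x'⁻¹.val.val * strictMatrix f * y⁻¹.val.val) * y.val.val by
      simp only [mul_assoc, unitriangular_inv_mul_val, mul_one], this,
      show strictMatrix f * (y⁻¹.val.val * y'.val.val) =
        x'.val.val * (x'⁻¹.val.val * strictMatrix f * y⁻¹.val.val) * y'.val.val by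
      simp only [← mul_assoc, unitriangular_mul_inv_val, one_mul]]
  · intro h f
    have hf : ∀ i j, j ≤ i → strictMatrix f i j = 0 := fun i j hij => by
      rw [strictMatrix_apply, dif_neg (not_lt.2 hij)]
    have := h fun β => (x'.val.val * strictMatrix f * y.val.val) β.row β.col
    rw [strictMatrix_eq_of_forall (strictUpper_mul_mul hf _ _)] at this
    rw [show x.val.val * strictMatrix f * y.val.val =
        x.val.val * x'⁻¹.val.val * (x'.val.val * strictMatrix f * y.val.val) by
      rw [mul_assoc x.val.val x'⁻¹.val.val, ← mul_assoc x'⁻¹.val.val,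
        ← mul_assoc x'⁻¹.val.val, unitriangular_inv_mul_val, one_mul, mul_assoc], this,
      show x'.val.val * strictMatrix f * y.val.val * (y⁻¹.val.val * y'.val.val) =
        x'.val.val * strictMatrix f * y'.val.val by
      rw [mul_assoc (x'.val.val * strictMatrix f), ← mul_assoc y.val.val,
        unitriangular_mul_inv_val, one_mul]]

open Classical in
/-- The inner product of supercharacters in terms of the number of solutions of `FormsAgree`. -/
theorem charInner_supercharacter [Fintype F] {φ : AddChar F ℂ} (hφ : φ ≠ 1)
    (P P' : BasicPair n φ) {t t' : PosRoot n → F} (ht : ∀ α ∈ P.1.1, t α ≠ 0)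
    (hl : ∀ α : P.1.1, IsBaseChar φ α.1 (t α.1) (P.2 α).1) (ht' : ∀ α ∈ P'.1.1, t' α ≠ 0)
    (hl' : ∀ α : P'.1.1, IsBaseChar φ α.1 (t' α.1) (P'.2 α).1) :
    charInner (supercharacter P) (supercharacter P') =
      (Fintype.card F : ℂ) ^ (∑ α ∈ P.1.1, (Finset.Ioo α.row α.col).card) *
      (Fintype.card F : ℂ) ^ (∑ α ∈ P'.1.1, (Finset.Ioo α.row α.col).card) *
      (Fintype.card (unitriangular n F) : ℂ)⁻¹ ^ 2 *
      ∑ x : unitriangular n F, ∑ y : unitriangular n F,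
        if FormsAgree P.1.1 P'.1.1 t t' x y then 1 else 0 := by
  set u : ℂ := ((Fintype.card (unitriangular n F) : ℕ) : ℂ) with hu
  have hu0 : u ≠ 0 := Nat.cast_ne_zero.2 Fintype.card_ne_zero
  set A : ℂ := (Fintype.card F : ℂ) ^ (∑ α ∈ P.1.1, (Finset.Ioo α.row α.col).card) with hA
  set A' : ℂ := (Fintype.card F : ℂ) ^ (∑ α ∈ P'.1.1, (Finset.Ioo α.row α.col).card) with hA'
  set S : ℂ := ∑ x : unitriangular n F, ∑ y : unitriangular n F,
    if FormsAgree P.1.1 P'.1.1 t t' x y then 1 else 0 with hS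
  have hconj : ∀ z : F, (starRingEnd ℂ) (φ z) = φ (-z) := fun z =>
    (AddChar.map_neg_eq_conj φ z).symm
  -- Orthogonality over g gives one factor u. The remaining condition involves only x x'⁻¹ and y⁻¹
  -- y', so two of the four summation variables are free and give u².
  have hquad : ∑ g : unitriangular n F,
      (∑ p : unitriangular n F × unitriangular n F,
        φ (rootForm P.1.1 t (p.1.val.val * (g.val.val - 1) * p.2.val.val))) *
      (starRingEnd ℂ) (∑ p : unitriangular n F × unitriangular n F,
        φ (rootForm P'.1.1 t' (p.1.val.val * (g.val.val - 1) * p.2.val.val))) =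
      u ^ 3 * S := by
    simp only [map_sum, hconj, Fintype.sum_mul_sum, ← AddChar.map_add_eq_mul]
    rw [Finset.sum_comm]
    have hinner : ∀ p p' : unitriangular n F × unitriangular n F,
        ∑ g : unitriangular n F,
          φ (rootForm P.1.1 t (p.1.val.val * (g.val.val - 1) * p.2.val.val) +
            -rootForm P'.1.1 t' (p'.1.val.val * (g.val.val - 1) * p'.2.val.val)) =
        u * if FormsAgree P.1.1 P'.1.1 t t' (p.1 * p'.1⁻¹) (p.2⁻¹ * p'.2) then 1 else 0 := by
      intro p p'
      have := sum_addChar_linear hφ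
        (rootForm P.1.1 t ∘ₗ LinearMap.mulLeftRight F (p.1.val.val, p.2.val.val) -
          rootForm P'.1.1 t' ∘ₗ LinearMap.mulLeftRight F (p'.1.val.val, p'.2.val.val))
      rw [if_congr (formsAgree_translate _ _ _ _) rfl rfl] at this
      simp only [LinearMap.sub_apply, LinearMap.comp_apply, LinearMap.mulLeftRight_apply] at this
      simp only [← sub_eq_add_neg, this, mul_ite, mul_one, mul_zero, hu]
    rw [Finset.sum_congr rfl fun p _ => (Finset.sum_comm.trans
      (Finset.sum_congr rfl fun p' _ => hinner p p'))]
    simp only [← Finset.mul_sum, Fintype.sum_prod_type]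
    have hswap : ∑ x : unitriangular n F, ∑ y : unitriangular n F, ∑ x' : unitriangular n F,
        ∑ y' : unitriangular n F,
          (if FormsAgree P.1.1 P'.1.1 t t' (x * x'⁻¹) (y⁻¹ * y') then (1 : ℂ) else 0) =
        ∑ _y : unitriangular n F, ∑ _x' : unitriangular n F, S := by
      rw [Finset.sum_comm]
      refine Finset.sum_congr rfl fun y _ => ?_
      rw [Finset.sum_comm]
      refine Finset.sum_congr rfl fun x' _ => ?_
      rw [hS, ← Equiv.sum_comp (Equiv.mulRight x'⁻¹) fun x => ∑ y : unitriangular n F,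
        if FormsAgree P.1.1 P'.1.1 t t' x y then (1 : ℂ) else 0]
      refine Finset.sum_congr rfl fun x _ => ?_
      exact Equiv.sum_comp (Equiv.mulLeft y⁻¹) fun z =>
        if FormsAgree P.1.1 P'.1.1 t t' (x * x'⁻¹) z then (1 : ℂ) else 0
    rw [hswap]
    simp only [Finset.sum_const, Finset.card_univ, nsmul_eq_mul]
    rw [← hu]
    ring
  unfold charInner
  -- Each supercharacter contributes u⁻²; with the u⁻¹ of the inner product and the u³ above, u⁻²
  -- remains.
  have hprod : ∀ g : unitriangular n F,
      supercharacter P g * (starRingEnd ℂ) (supercharacter P' g) =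
      A * A' * u⁻¹ ^ 4 * ((∑ p : unitriangular n F × unitriangular n F,
        φ (rootForm P.1.1 t (p.1.val.val * (g.val.val - 1) * p.2.val.val))) *
      (starRingEnd ℂ) (∑ p : unitriangular n F × unitriangular n F,
        φ (rootForm P'.1.1 t' (p.1.val.val * (g.val.val - 1) * p.2.val.val)))) := by
    intro g
    rw [supercharacter_apply hφ P ht hl, supercharacter_apply hφ P' ht' hl']
    simp only [map_mul, map_pow, map_inv₀, map_natCast, hA, hA', hu]
    ring
  rw [Finset.sum_congr rfl fun g _ => hprod g, ← Finset.mul_sum, hquad, Nat.card_eq_fintype_card,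
    ← hu]
  field_simp

end Forms

/-! ### The inner product formula -/

section Final

variable {n : ℕ} {F : Type*} [Field F]

theorem card_VD_mul_relIndex [Finite F] (D : Finset (PosRoot n)) :
    Nat.card (VD F D) * (VD F D).relIndex (VD F D ⊔ RD F D) =
      Nat.card (VD F D ⊔ RD F D : Subgroup (unitriangular n F)) := by
  have := Subgroup.relIndex_mul_relIndex ⊥ (VD F D) (VD F D ⊔ RD F D) bot_le le_sup_left
  rwa [Subgroup.relIndex_bot_left, Subgroup.relIndex_bot_left] at this

/-- A basic pair is determined by its basic set and the coefficients of its character choice. -/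
theorem basicPair_ext {φ : AddChar F ℂ} {P P' : BasicPair n φ} {t t' : PosRoot n → F}
    (hl : ∀ α : P.1.1, IsBaseChar φ α.1 (t α.1) (P.2 α).1)
    (hl' : ∀ α : P'.1.1, IsBaseChar φ α.1 (t' α.1) (P'.2 α).1)
    (hD : P.1.1 = P'.1.1) (ht : ∀ α ∈ P.1.1, t α = t' α) : P = P' := by
  obtain ⟨⟨D, hb⟩, l⟩ := P
  obtain ⟨⟨D', hb'⟩, l'⟩ := P'
  obtain rfl : D = D' := hD
  congr 1
  funext α
  refine Subtype.ext (MonoidHom.ext fun x => Units.ext ?_)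
  rw [(hl α).apply, (hl' α).apply, ht α.1 α.2]

open Classical in
/-- The number of solutions of the double orbit equations for a single basic form. -/
theorem sum_formsAgree_self [Fintype F] {D : Finset (PosRoot n)} (hD : IsBasic D)
    {t : PosRoot n → F} (ht : ∀ α ∈ D, t α ≠ 0) :
    (∑ x : unitriangular n F, ∑ y : unitriangular n F,
      if FormsAgree D D t t x y then (1 : ℂ) else 0) =
    Nat.card (VD F D ⊔ RD F D : Subgroup (unitriangular n F)) * Nat.card (VD F D) := by
  have hq : Fintype.card F ^ (∑ α ∈ D, (Finset.Ioo α.row α.col).card) ≠ 0 :=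
    pow_ne_zero _ Fintype.card_ne_zero
  have hinner : ∀ x : unitriangular n F,
      (∑ y : unitriangular n F, if FormsAgree D D t t x y then (1 : ℂ) else 0) =
        if x ∈ VD F D ⊔ RD F D then (Nat.card (VD F D) : ℂ) else 0 := by
    intro x
    simp only [formsAgree_iff, entriesAgree_self_iff hD ht]
    split_ifs with hx
    · simp only [hx, true_and, Finset.sum_boole]
      congr 1
      -- The values that x prescribes on the legs do not affect how many y attain them.
      exact mul_right_cancel₀ hq ((card_prescribed_legs_mul hD _).trans (card_VD_mul hD).symm)
    · simp only [hx, false_and, if_false, Finset.sum_const_zero]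
  rw [Finset.sum_congr rfl fun x _ => hinner x, ← Finset.sum_filter, Finset.sum_const,
    nsmul_eq_mul, Nat.card_eq_fintype_card (α := (VD F D ⊔ RD F D : Subgroup _)),
    Fintype.card_subtype]

end Final

open Classical in
theorem mainTheorem4 {F : Type*} [Field F] [Finite F] (n : ℕ) (φ : AddChar F ℂ) (hφ : φ ≠ 1)
    (P P' : BasicPair n φ) :
    charInner (supercharacter P) (supercharacter P') =
      if P = P' then
        (((VD F P.1.1).relIndex (VD F P.1.1 ⊔ RD F P.1.1) : ℕ) : ℂ)
      else 0 := by
  have : Fintype F := Fintype.ofFinite F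
  obtain ⟨t, ht, hl⟩ := exists_coeff P
  split_ifs with hPP
  · subst hPP
    -- The value is q^{2N} |U|⁻² |V_D R_D| |V_D|; with |U| = |V_D| q^N this is |V_D R_D| / |V_D|.
    rw [charInner_supercharacter hφ P P ht hl ht hl, sum_formsAgree_self P.1.2 ht,
      ← card_VD_mul_relIndex, ← card_VD_mul P.1.2]
    have hV : (Nat.card (VD F P.1.1) : ℂ) ≠ 0 := Nat.cast_ne_zero.2 Nat.card_pos.ne'
    have hq : (Fintype.card F : ℂ) ≠ 0 := Nat.cast_ne_zero.2 Fintype.card_ne_zero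
    push_cast
    field_simp
  · obtain ⟨t', ht', hl'⟩ := exists_coeff P'
    rw [charInner_supercharacter hφ P P' ht hl ht' hl']
    refine mul_eq_zero_of_right _ (Finset.sum_eq_zero fun x _ => Finset.sum_eq_zero fun y _ => ?_)
    refine if_neg fun h => hPP ?_
    obtain ⟨hD, htt⟩ := (formsAgree_iff.1 h).eq P.1.2 P'.1.2 ht ht'
    exact basicPair_ext hl hl' hD htt
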